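/- Let $\nu>0$ be a real number, let $\epsilon>0$, $D=\{y\in\mathbb{C}:|y|<\epsilon\}$, and let $\mathcal{O}_b(D)$ be the Banach space of bounded analytic functions on $D$ with the supremum norm. Definitions. Let $E$ be $\mathbb{C}$ or $\mathcal{O}_b(D)$ and let $\hat f(x)=\sum_{n\ge 0}f^{(n)}x^n\in E[[x]]$. Sectors are open sectors $\{a<\arg x<b,\ 0<|x|<r\}$ with vertex $0$ on the Riemann surface of the logarithm. An analytic function $f:U\to E$ on a sector $U$ is $\frac1\nu$-Gevrey asymptotic to $\hat f$ if for every sector $V$ with $\overline V\subset U\cup\{0\}$ there are $C,A>0$ such that $$\Big\|f(x)-\sum_{n=0}^{N-1}f^{(n)}x^n\Big\|\le C\,|x|^N A^N\,\Gamma\big(1+\tfrac N\nu\big)\qquad\text{for all integers } N>0 \text{ and all } x\in V.$$ The series $\hat f$ is Borel $\nu$-summable in the direction $\alpha\in\mathbb{R}$ if there are a sector $U$ of angular width $>\frac{\pi}{\nu}$ bisected by $\alpha$ and an analytic function $f_\alpha:U\to E$ that is $\frac1\nu$-Gevrey asymptotic to $\hat f$. The singular directions of $\hat f$ are the $\alpha\in[0,2\pi)$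 in which it is not Borel $\nu$-summable, and $\hat f$ is Borel $\nu$-summable if it has only finitely many singular directions. Proposition. Let $\hat F(x,y)=\sum_{j\ge 0}F^{(j)}(y)x^j$ be a formal power series in $x$ with coefficients $F^{(j)}\in\mathcal{O}_b(D)$ that is Borel $\nu$-summable (with $E=\mathcal{O}_b(D)$). Suppose that $F^{(0)}(0)=0$ and $\frac{dF^{(0)}}{dy}(0)\ne 0$. Then there is a unique formal power series $\hat g(x)=\sum_{j\ge 0}g^{(j)}x^j\in\mathbb{C}[[x]]$ with $g^{(0)}=0$ and $$\hat F(x,\hat g(x))=\sum_{j\ge 0}F^{(j)}(\hat g(x))\,x^j=0,$$ where $F^{(j)}(\hat g(x))$ is the formal substitution of $\hat g$ into the Taylor series of $F^{(j)}$ at $0$. Moreover, $\hat g$ is Borel $\nu$-summable (with $E=\mathbb{C}$), and every singular direction of $\hat g$ is a singular direction of $\hat F$. -/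

import Mathlib

open scoped BoundedContinuousFunction

namespace BorelIFT

noncomputable section

/-- The open sector `{a < arg x < b, 0 < |x| < r}` with vertex `0` on the Riemann surface of the
logarithm, in the global coordinate `w = log x` (so `x = exp w`, `|x| = ‖exp w‖`, `arg x = w.im`).
It is empty when `b ≤ a` or `r ≤ 0`. -/
def sector (a b r : ℝ) : Set ℂ :=
  {w | a < w.im ∧ w.im < b ∧ ‖Complex.exp w‖ < r}

/-- `f` (a function on a subset `U` of the Riemann surface of the logarithm, written in the
coordinate `w = log x`) is analytic on `U` and `s`-Gevrey asymptotic to `∑ n, c n * x ^ n`: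
on every sector `V` whose closure lies in `U` (apart from the vertex `0`, which is at infinity in
the coordinate `w`) there are `C, A > 0` such that, for all `N > 0` and all `x ∈ V`,
`‖f x - ∑ n < N, c n x ^ n‖ ≤ C |x| ^ N A ^ N Γ(1 + s N)`. -/
def IsGevreyAsymptotic {E : Type*} [NormedAddCommGroup E] [NormedSpace ℂ E]
    (s : ℝ) (U : Set ℂ) (f : ℂ → E) (c : ℕ → E) : Prop :=
  AnalyticOnNhd ℂ f U ∧
  ∀ a b r : ℝ, closure (sector a b r) ⊆ U →
    ∃ C A : ℝ, 0 < C ∧ 0 < A ∧ ∀ N : ℕ, 0 < N → ∀ w ∈ sector a b r,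
      ‖f w - ∑ n ∈ Finset.range N, Complex.exp w ^ n • c n‖ ≤
        C * ‖Complex.exp w‖ ^ N * A ^ N * Real.Gamma (1 + s * N)

/-- The formal power series `∑ n, c n * x ^ n` is Borel `ν`-summable in the direction `α`: on some
open sector of angular width `2 * δ > π / ν` bisected by `α` there is an analytic function that is
`1 / ν`-Gevrey asymptotic to it. -/
def BorelSummableInDirection {E : Type*} [NormedAddCommGroup E] [NormedSpace ℂ E]
    (ν : ℝ) (c : ℕ → E) (α : ℝ) : Prop :=
  ∃ δ ρ : ℝ, Real.pi / ν < 2 * δ ∧ 0 < ρ ∧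
    ∃ f : ℂ → E, IsGevreyAsymptotic (1 / ν) (sector (α - δ) (α + δ) ρ) f c

/-- The singular (anti-Stokes) directions in `[0, 2π)`. -/
def singularDirections {E : Type*} [NormedAddCommGroup E] [NormedSpace ℂ E]
    (ν : ℝ) (c : ℕ → E) : Set ℝ :=
  {α | α ∈ Set.Ico 0 (2 * Real.pi) ∧ ¬ BorelSummableInDirection ν c α}

/-- Borel `ν`-summability: summable in all but finitely many directions in `[0, 2π)`. -/
def BorelSummable {E : Type*} [NormedAddCommGroup E] [NormedSpace ℂ E]
    (ν : ℝ) (c : ℕ → E) : Prop :=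
  (singularDirections ν c).Finite

/-- The space of bounded analytic functions on the disc `{|y| < ε}` with the supremum norm. -/
def BoundedAnalytic (ε : ℝ) : Submodule ℂ (Metric.ball (0 : ℂ) ε →ᵇ ℂ) where
  carrier := {F | ∃ φ : ℂ → ℂ, AnalyticOnNhd ℂ φ (Metric.ball 0 ε) ∧
    ∀ y : Metric.ball (0 : ℂ) ε, F y = φ y}
  zero_mem' := ⟨fun _ => 0, analyticOnNhd_const, fun _ => rfl⟩
  add_mem' := by
    rintro F G ⟨φ, hφ, hF⟩ ⟨ψ, hψ, hG⟩
    exact ⟨φ + ψ, hφ.add hψ, fun y => by simp [hF, hG]⟩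
  smul_mem' := by
    rintro c F ⟨φ, hφ, hF⟩
    exact ⟨fun y => c • φ y, analyticOnNhd_const.smul hφ, fun y => by simp [hF]⟩

/-- An element of `BoundedAnalytic ε` as a function on `ℂ`, extended by `0` outside the disc. -/
def discEval {ε : ℝ} (F : BoundedAnalytic ε) : ℂ → ℂ :=
  Function.extend Subtype.val (F : Metric.ball (0 : ℂ) ε →ᵇ ℂ) 0

/-- The Taylor series of `F` at `y = 0`. -/
def taylorSeries {ε : ℝ} (F : BoundedAnalytic ε) : PowerSeries ℂ :=
  PowerSeries.mk fun k => iteratedDeriv k (discEval F) 0 / (k.factorial : ℂ)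

/-- The formal power series `∑ j, F j (g x) * x ^ j` for a formal power series `g` without constant
term; its coefficient of `x ^ n` is the sum over `j + m = n` of the coefficient of `x ^ m` in the
series `F j (g x)`, the formal substitution of `g` into the Taylor series of `F j`. -/
def formalSubst {ε : ℝ} (F : ℕ → BoundedAnalytic ε) (g : PowerSeries ℂ) : PowerSeries ℂ :=
  PowerSeries.mk fun n => ∑ p ∈ Finset.HasAntidiagonal.antidiagonal n,
    PowerSeries.coeff p.2 (PowerSeries.subst g (taylorSeries (F p.1)) : PowerSeries ℂ)

end

end BorelIFT

/-!
The formal equation is solved `X`-adically: `g ↦ formalSubst F g` changes, to first order, by the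
factor `(F 0)'(0) ≠ 0` times the change of `g` (`X_pow_succ_dvd_twoVarSubst_sub`). This gives
existence and uniqueness of the formal solution, and also uniqueness modulo `X ^ N`
(`X_pow_dvd_sub_of_X_pow_dvd_twoVarSubst`).

For summability, fix a direction in which `F` is summable, with sum `f`. On a sector of slightly
smaller opening and radius, `f w` is close to `F 0` in the sup norm, so the map
`y ↦ y - f w y / (F 0)'(0)` contracts a fixed small disc and `f w` has a zero `φ w` there, which
depends holomorphically on `w` (`exists_differentiableOn_zero`). To compare `φ` with the formal
solution `g`, for each `N` the truncated equation `∑ j < N, x ^ j * F j y = 0` is solved by the same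
contraction. Since `‖F j‖ ≤ C A ^ j Γ(1 + s j)`, with `s = 1 / ν`, and
`Γ(1 + s j) ≤ (Γ(1 + s N) ^ (1 / N)) ^ j` for `j ≤ N` by logarithmic convexity, this works on the
disc of radius `R = c / Γ(1 + s N) ^ (1 / N)` with `c` independent of `N`, and yields a holomorphic
`h` with values in the fixed disc, whose Taylor series agrees with `g` modulo `X ^ N`
(`exists_solution_of_truncation`). Here `R ^ (-N)` is `c ^ (-N) Γ(1 + s N)`, exactly the size
allowed in a Gevrey estimate. For `‖x‖` at most a fixed fraction of `R`, the difference
`φ w - h x`, where `x = exp w`, is controlled by the difference of `f w` and the truncation, and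
`h` minus its Taylor polynomial by Cauchy's estimates; for larger `‖x‖` both `φ w` and the Taylor
polynomial are trivially of size `(‖x‖ / R) ^ N` up to a factor `B ^ N` with `B` a constant
(`norm_sub_sum_le_of_lt`).
-/

namespace BorelIFT

/-! ### The formal implicit function theorem -/

section Formal

open PowerSeries

/-- The formal power series `∑ j, a j (g x) * x ^ j`, for formal power series `a j` and a formal
power series `g` without constant term. -/
noncomputable def twoVarSubst (a : ℕ → PowerSeries ℂ) (g : PowerSeries ℂ) : PowerSeries ℂ :=
  PowerSeries.mk fun n => ∑ p ∈ Finset.HasAntidiagonal.antidiagonal n,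
    PowerSeries.coeff p.2 (PowerSeries.subst g (a p.1) : PowerSeries ℂ)

theorem formalSubst_eq_twoVarSubst {ε : ℝ} (F : ℕ → BoundedAnalytic ε) (g : PowerSeries ℂ) :
    formalSubst F g = twoVarSubst (fun j => taylorSeries (F j)) g := rfl

theorem X_pow_dvd_subst_sub_subst {g h : PowerSeries ℂ} (hg : constantCoeff g = 0)
    (hh : constantCoeff h = 0) {n : ℕ} (hgh : X ^ n ∣ g - h) (b : PowerSeries ℂ) :
    X ^ n ∣ (subst g b : PowerSeries ℂ) - subst h b := by
  rw [X_pow_dvd_iff]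
  intro m hm
  rw [map_sub, coeff_subst' (HasSubst.of_constantCoeff_zero' hg),
    coeff_subst' (HasSubst.of_constantCoeff_zero' hh), sub_eq_zero]
  refine finsum_congr fun d => ?_
  have h1 : X ^ n ∣ g ^ d - h ^ d := hgh.trans (sub_dvd_pow_sub_pow g h d)
  have h2 := X_pow_dvd_iff.1 h1 m hm
  rw [map_sub, sub_eq_zero] at h2
  rw [h2]

theorem exists_eq_C_add_X_mul_C_add (b : PowerSeries ℂ) :
    ∃ q : PowerSeries ℂ, b = C (coeff 0 b) + X * (C (coeff 1 b) + X * q) := by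
  refine ⟨PowerSeries.mk fun p => coeff (p + 2) b, ?_⟩
  ext n
  rcases n with _ | _ | n <;> simp [coeff_succ_X_mul]

/-- Substitution is, to first order, multiplication by the linear coefficient. -/
theorem X_pow_succ_dvd_subst_sub_subst_sub {g h : PowerSeries ℂ} (hg : constantCoeff g = 0)
    (hh : constantCoeff h = 0) {n : ℕ} (hgh : X ^ n ∣ g - h) (b : PowerSeries ℂ) :
    X ^ (n + 1) ∣ (subst g b : PowerSeries ℂ) - subst h b - C (coeff 1 b) * (g - h) := by
  obtain ⟨q, hq⟩ := exists_eq_C_add_X_mul_C_add b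
  have key : ∀ u : PowerSeries ℂ, constantCoeff u = 0 → (subst u b : PowerSeries ℂ) =
      C (coeff 0 b) + u * (C (coeff 1 b) + u * subst u q) := by
    intro u hu
    have hs := HasSubst.of_constantCoeff_zero' hu
    have hC : ∀ r : ℂ, (subst u (C r) : PowerSeries ℂ) = C r := fun r => subst_C r
    conv_lhs => rw [hq]
    rw [subst_add hs, subst_mul hs, subst_add hs, subst_mul hs, subst_X hs, hC, hC]
  have e : (subst g b : PowerSeries ℂ) - subst h b - C (coeff 1 b) * (g - h) =
      (subst g q - subst h q) * (g * g) + (g - h) * (g + h) * subst h q := by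
    rw [key g hg, key h hh]; ring
  rw [e]
  have hXg : X ∣ g := X_dvd_iff.2 hg
  have hXh : X ∣ h := X_dvd_iff.2 hh
  rw [pow_succ]
  exact dvd_add
    (mul_dvd_mul (X_pow_dvd_subst_sub_subst hg hh hgh q) (hXg.mul_right g))
    ((mul_dvd_mul hgh (dvd_add hXg hXh)).mul_right _)

/-- Only the linear coefficient of `a 0` contributes to the first-order change of
`twoVarSubst a` under a perturbation. -/
theorem X_pow_succ_dvd_twoVarSubst_sub (a : ℕ → PowerSeries ℂ) {g h : PowerSeries ℂ}
    (hg : constantCoeff g = 0) (hh : constantCoeff h = 0) {n : ℕ} (hgh : X ^ n ∣ g - h) :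
    X ^ (n + 1) ∣ twoVarSubst a g - twoVarSubst a h - C (coeff 1 (a 0)) * (g - h) := by
  rw [X_pow_dvd_iff]
  intro m hm
  have h0 := X_pow_dvd_iff.1 (X_pow_succ_dvd_subst_sub_subst_sub hg hh hgh (a 0)) m hm
  rw [map_sub, map_sub] at h0 ⊢
  rw [← h0]
  congr 1
  simp only [twoVarSubst, coeff_mk]
  rw [← Finset.sum_sub_distrib]
  rw [Finset.sum_eq_single_of_mem (0, m) (by simp)]
  rintro ⟨j, i⟩ hji hne
  rw [Finset.HasAntidiagonal.mem_antidiagonal] at hji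
  have hi : i < n := by
    have : j ≠ 0 := by
      rintro rfl
      exact hne (by simp at hji; simp [hji])
    simp only at hji
    omega
  have := X_pow_dvd_iff.1 (X_pow_dvd_subst_sub_subst hg hh hgh (a j)) i hi
  simpa using this

theorem constantCoeff_twoVarSubst (a : ℕ → PowerSeries ℂ) (h0 : coeff 0 (a 0) = 0)
    {g : PowerSeries ℂ} (hg : constantCoeff g = 0) : constantCoeff (twoVarSubst a g) = 0 := by
  obtain ⟨q, hq⟩ := exists_eq_C_add_X_mul_C_add (a 0)
  have hs := HasSubst.of_constantCoeff_zero' hg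
  rw [h0, map_zero, zero_add] at hq
  rw [← coeff_zero_eq_constantCoeff_apply, twoVarSubst, coeff_mk]
  rw [Finset.Nat.antidiagonal_zero, Finset.sum_singleton]
  rw [hq, subst_mul hs, subst_X hs, coeff_zero_eq_constantCoeff_apply, map_mul, hg, zero_mul]

/-- A formal series that solves the equation modulo `X ^ N` agrees modulo `X ^ N` with every
formal solution. -/
theorem X_pow_dvd_sub_of_X_pow_dvd_twoVarSubst {a : ℕ → PowerSeries ℂ}
    (h1 : coeff 1 (a 0) ≠ 0) {g h : PowerSeries ℂ} (hg : constantCoeff g = 0)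
    (hh : constantCoeff h = 0) (hg0 : twoVarSubst a g = 0) {N : ℕ}
    (hN : X ^ N ∣ twoVarSubst a h) : X ^ N ∣ g - h := by
  suffices ∀ n ≤ N, X ^ n ∣ g - h from this N le_rfl
  intro n
  induction n with
  | zero => simp
  | succ n ih =>
    intro hn
    have hd := X_pow_succ_dvd_twoVarSubst_sub a hg hh (ih (by omega))
    have hd2 : X ^ (n + 1) ∣ twoVarSubst a h := (pow_dvd_pow X hn).trans hN
    have e : g - h = -(C (coeff 1 (a 0))⁻¹ * ((twoVarSubst a g - twoVarSubst a h -
        C (coeff 1 (a 0)) * (g - h)) + twoVarSubst a h)) := by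
      have : (C (coeff 1 (a 0))⁻¹ * C (coeff 1 (a 0)) : PowerSeries ℂ) = 1 := by
        rw [← map_mul, inv_mul_cancel₀ h1, map_one]
      rw [hg0]
      linear_combination (-(g - h)) * this
    rw [e]
    exact (dvd_neg.2 ((dvd_add hd hd2).mul_left _))

/-- One step of Newton's method with frozen derivative for the formal equation
`twoVarSubst a g = 0`. -/
noncomputable def formalNewton (a : ℕ → PowerSeries ℂ) (g : PowerSeries ℂ) : PowerSeries ℂ :=
  g - C (coeff 1 (a 0))⁻¹ * twoVarSubst a g

theorem X_pow_succ_dvd_formalNewton_sub {a : ℕ → PowerSeries ℂ}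
    (h1 : coeff 1 (a 0) ≠ 0) {g h : PowerSeries ℂ} (hg : constantCoeff g = 0)
    (hh : constantCoeff h = 0) {n : ℕ} (hgh : X ^ n ∣ g - h) :
    X ^ (n + 1) ∣ formalNewton a g - formalNewton a h := by
  have e : formalNewton a g - formalNewton a h = -(C (coeff 1 (a 0))⁻¹ *
      (twoVarSubst a g - twoVarSubst a h - C (coeff 1 (a 0)) * (g - h))) := by
    have : (C (coeff 1 (a 0))⁻¹ * C (coeff 1 (a 0)) : PowerSeries ℂ) = 1 := by
      rw [← map_mul, inv_mul_cancel₀ h1, map_one]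
    rw [formalNewton, formalNewton]
    linear_combination (-(g - h)) * this
  rw [e]
  exact dvd_neg.2 ((X_pow_succ_dvd_twoVarSubst_sub a hg hh hgh).mul_left _)

/-- The formal implicit function theorem, existence: the iterates of `formalNewton` converge
`X`-adically to a solution. -/
theorem exists_twoVarSubst_eq_zero {a : ℕ → PowerSeries ℂ} (h0 : coeff 0 (a 0) = 0)
    (h1 : coeff 1 (a 0) ≠ 0) :
    ∃ g : PowerSeries ℂ, constantCoeff g = 0 ∧ twoVarSubst a g = 0 := by
  set u : ℕ → PowerSeries ℂ := fun n => (formalNewton a)^[n] 0 with hu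
  have us : ∀ n, u (n + 1) = formalNewton a (u n) := fun n =>
    Function.iterate_succ_apply' _ _ _
  have hT : ∀ g : PowerSeries ℂ, constantCoeff g = 0 → constantCoeff (formalNewton a g) = 0 := by
    intro g hg
    rw [formalNewton, map_sub, map_mul, constantCoeff_twoVarSubst a h0 hg, hg]; simp
  have uc : ∀ n, constantCoeff (u n) = 0 := by
    intro n
    induction n with
    | zero => simp [hu]
    | succ n ih => rw [us]; exact hT _ ih
  have ud : ∀ n, X ^ n ∣ u (n + 1) - u n := by
    intro n
    induction n with
    | zero => simp
    | succ n ih =>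
      have := X_pow_succ_dvd_formalNewton_sub h1 (uc (n + 1)) (uc n) ih
      rwa [← us n, ← us (n + 1)] at this
  have ud' : ∀ n k, X ^ n ∣ u (n + k) - u n := by
    intro n k
    induction k with
    | zero => simp
    | succ k ih =>
      have e : u (n + (k + 1)) - u n = (u (n + k + 1) - u (n + k)) + (u (n + k) - u n) := by
        rw [← add_assoc]; ring
      rw [e]
      exact dvd_add ((pow_dvd_pow X (Nat.le_add_right n k)).trans (ud _)) ih
  set g : PowerSeries ℂ := PowerSeries.mk fun n => coeff n (u (n + 1)) with hgdef
  have gd : ∀ n, X ^ n ∣ g - u n := by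
    intro n
    rw [X_pow_dvd_iff]
    intro m hm
    obtain ⟨k, rfl⟩ := Nat.exists_eq_add_of_le (Nat.succ_le_of_lt hm)
    have := X_pow_dvd_iff.1 (ud' (m + 1) k) m (Nat.lt_succ_self m)
    rw [map_sub, sub_eq_zero] at this
    rw [map_sub, hgdef, coeff_mk, sub_eq_zero]
    exact this.symm
  have gc : constantCoeff g = 0 := by
    have := X_pow_dvd_iff.1 (gd 1) 0 one_pos
    rw [map_sub, coeff_zero_eq_constantCoeff_apply, coeff_zero_eq_constantCoeff_apply, uc,
      sub_zero] at this
    exact this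
  refine ⟨g, gc, ?_⟩
  have hfix : formalNewton a g = g := by
    rw [← sub_eq_zero]
    ext m
    have d1 := X_pow_succ_dvd_formalNewton_sub h1 gc (uc m) (gd m)
    rw [← us m] at d1
    have d2 := dvd_sub d1 (gd (m + 1))
    have e : formalNewton a g - u (m + 1) - (g - u (m + 1)) = formalNewton a g - g := by ring
    rw [e] at d2
    simpa using X_pow_dvd_iff.1 d2 m (Nat.lt_succ_self m)
  rw [formalNewton, sub_eq_self] at hfix
  refine (mul_eq_zero.1 hfix).resolve_left fun hC => h1 ?_
  have := congrArg constantCoeff hC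
  simpa using this

theorem eq_of_twoVarSubst_eq_zero {a : ℕ → PowerSeries ℂ} (h1 : coeff 1 (a 0) ≠ 0)
    {g h : PowerSeries ℂ} (hg : constantCoeff g = 0) (hh : constantCoeff h = 0)
    (hg0 : twoVarSubst a g = 0) (hh0 : twoVarSubst a h = 0) : h = g := by
  rw [eq_comm, ← sub_eq_zero]
  ext m
  have : X ^ (m + 1) ∣ g - h :=
    X_pow_dvd_sub_of_X_pow_dvd_twoVarSubst h1 hg hh hg0 (by simp [hh0])
  simpa using X_pow_dvd_iff.1 this m (Nat.lt_succ_self m)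

end Formal

/-! ### Bounded analytic functions on a disc -/

section Disc

open Metric

variable {ε : ℝ}

theorem discEval_apply (F : BoundedAnalytic ε) {y : ℂ} (hy : y ∈ ball (0 : ℂ) ε) :
    discEval F y = (F : ball (0 : ℂ) ε →ᵇ ℂ) ⟨y, hy⟩ :=
  Subtype.val_injective.extend_apply _ _ (⟨y, hy⟩ : ball (0 : ℂ) ε)

theorem discEval_of_notMem (F : BoundedAnalytic ε) {y : ℂ} (hy : y ∉ ball (0 : ℂ) ε) :
    discEval F y = 0 :=
  Function.extend_apply' _ _ _ (by rintro ⟨⟨z, hz⟩, rfl⟩; exact hy hz)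

theorem norm_discEval_le (F : BoundedAnalytic ε) (y : ℂ) : ‖discEval F y‖ ≤ ‖F‖ := by
  by_cases hy : y ∈ ball (0 : ℂ) ε
  · rw [discEval_apply F hy]
    exact BoundedContinuousFunction.norm_coe_le_norm _ _
  · rw [discEval_of_notMem F hy, norm_zero]
    exact norm_nonneg F

theorem discEval_add (F G : BoundedAnalytic ε) (y : ℂ) :
    discEval (F + G) y = discEval F y + discEval G y := by
  by_cases hy : y ∈ ball (0 : ℂ) ε
  · rw [discEval_apply _ hy, discEval_apply _ hy, discEval_apply _ hy]; rfl
  · rw [discEval_of_notMem _ hy, discEval_of_notMem _ hy, discEval_of_notMem _ hy, add_zero]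

theorem discEval_smul (c : ℂ) (F : BoundedAnalytic ε) (y : ℂ) :
    discEval (c • F) y = c * discEval F y := by
  by_cases hy : y ∈ ball (0 : ℂ) ε
  · rw [discEval_apply _ hy, discEval_apply _ hy]; rfl
  · rw [discEval_of_notMem _ hy, discEval_of_notMem _ hy, mul_zero]

/-- Evaluation at `y` as a linear functional. -/
noncomputable def discEvalLM (ε : ℝ) (y : ℂ) : BoundedAnalytic ε →ₗ[ℂ] ℂ where
  toFun F := discEval F y
  map_add' F G := discEval_add F G y
  map_smul' c F := discEval_smul c F y

/-- Evaluation at `y` as a continuous linear functional. -/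
noncomputable def discEvalCLM (ε : ℝ) (y : ℂ) : BoundedAnalytic ε →L[ℂ] ℂ :=
  (discEvalLM ε y).mkContinuous 1 fun F => (norm_discEval_le F y).trans_eq (one_mul _).symm

theorem discEvalCLM_apply (F : BoundedAnalytic ε) (y : ℂ) : discEvalCLM ε y F = discEval F y := rfl

theorem discEval_sub (F G : BoundedAnalytic ε) (y : ℂ) :
    discEval (F - G) y = discEval F y - discEval G y := map_sub (discEvalCLM ε y) F G

theorem differentiableOn_discEval (F : BoundedAnalytic ε) :
    DifferentiableOn ℂ (discEval F) (ball 0 ε) := by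
  obtain ⟨φ, hφ, hF⟩ := F.2
  exact hφ.differentiableOn.congr fun y hy => by rw [discEval_apply F hy]; exact hF ⟨y, hy⟩

theorem differentiableAt_discEval (F : BoundedAnalytic ε) {y : ℂ} (hy : y ∈ ball (0 : ℂ) ε) :
    DifferentiableAt ℂ (discEval F) y :=
  (differentiableOn_discEval F).differentiableAt (isOpen_ball.mem_nhds hy)

theorem norm_deriv_discEval_le (hε : 0 < ε) (F : BoundedAnalytic ε) {y : ℂ}
    (hy : y ∈ ball (0 : ℂ) (ε / 2)) : ‖deriv (discEval F) y‖ ≤ ‖F‖ / (ε / 4) := by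
  refine Complex.norm_deriv_le_of_forall_mem_sphere_norm_le (by positivity) ?_
    fun z _ => norm_discEval_le F z
  refine DifferentiableOn.diffContOnCl ((differentiableOn_discEval F).mono ?_)
  refine closure_ball_subset_closedBall.trans (closedBall_subset_ball' ?_)
  rw [mem_ball] at hy
  linarith

theorem norm_discEval_sub_le (hε : 0 < ε) (F : BoundedAnalytic ε) {y z : ℂ}
    (hy : y ∈ ball (0 : ℂ) (ε / 2)) (hz : z ∈ ball (0 : ℂ) (ε / 2)) :
    ‖discEval F y - discEval F z‖ ≤ ‖F‖ / (ε / 4) * ‖y - z‖ :=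
  Convex.norm_image_sub_le_of_norm_deriv_le
    (fun _ hx => differentiableAt_discEval F (ball_subset_ball (by linarith) hx))
    (fun _ hx => norm_deriv_discEval_le hε F hx) (convex_ball 0 (ε / 2)) hz hy

/-- Evaluation is differentiable jointly in the function and in the point. -/
theorem DifferentiableAt.discEval_comp (hε : 0 < ε) {Ψ : ℂ → BoundedAnalytic ε} {φ : ℂ → ℂ}
    {u₀ : ℂ} (hΨ : DifferentiableAt ℂ Ψ u₀) (hφ : DifferentiableAt ℂ φ u₀)
    (hu₀ : φ u₀ ∈ ball (0 : ℂ) (ε / 2)) :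
    DifferentiableAt ℂ (fun u => discEval (Ψ u) (φ u)) u₀ := by
  have e : (fun u => discEval (Ψ u) (φ u)) = fun u =>
      (discEval (Ψ u₀) (φ u) + discEvalCLM ε (φ u₀) (Ψ u - Ψ u₀)) +
        (discEval (Ψ u - Ψ u₀) (φ u) - discEval (Ψ u - Ψ u₀) (φ u₀)) := by
    funext u
    simp only [discEvalCLM_apply, discEval_sub]; ring
  rw [e]
  refine DifferentiableAt.add (DifferentiableAt.add ?_ ?_) ?_
  · exact (differentiableAt_discEval (Ψ u₀) (ball_subset_ball (by linarith) hu₀)).comp u₀ hφ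
  · exact (discEvalCLM ε (φ u₀)).differentiableAt.comp u₀ (hΨ.sub_const _)
  · -- the mixed term is of second order, hence has derivative `0`
    refine HasDerivAt.differentiableAt (f' := 0) ?_
    rw [hasDerivAt_iff_isLittleO]
    simp only [sub_self, smul_zero, sub_zero]
    have h1 : (fun u => Ψ u - Ψ u₀) =O[nhds u₀] fun u => u - u₀ := hΨ.isBigO_sub
    have h2 : (fun u => φ u - φ u₀) =O[nhds u₀] fun u => u - u₀ := hφ.isBigO_sub
    have h3 : (fun u => discEval (Ψ u - Ψ u₀) (φ u) - discEval (Ψ u - Ψ u₀) (φ u₀))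
        =O[nhds u₀] fun u => ‖Ψ u - Ψ u₀‖ * ‖φ u - φ u₀‖ := by
      refine Asymptotics.IsBigO.of_bound (1 / (ε / 4)) ?_
      filter_upwards [hφ.continuousAt.preimage_mem_nhds (isOpen_ball.mem_nhds hu₀)] with u hu
      refine (norm_discEval_sub_le hε _ hu hu₀).trans (le_of_eq ?_)
      rw [Real.norm_of_nonneg (by positivity)]; ring
    have h4 := h3.trans (h1.norm_left.mul h2.norm_left)
    refine h4.trans_isLittleO ?_
    have h5 : (fun u : ℂ => u - u₀) =o[nhds u₀] fun _ => (1 : ℂ) := by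
      rw [Asymptotics.isLittleO_one_iff]
      have : Filter.Tendsto (fun u : ℂ => u - u₀) (nhds u₀) (nhds (u₀ - u₀)) :=
        (continuous_id.sub continuous_const).tendsto u₀
      simpa using this
    simpa using h5.mul_isBigO (Asymptotics.isBigO_refl (fun u : ℂ => u - u₀) (nhds u₀))

end Disc

/-! ### Zeros depending holomorphically on a parameter -/

section Zero

open Metric Filter Topology

variable {ε : ℝ}

/-- For every `G` within distance `κ` of `F₀`, the Newton map `y ↦ y - G y / F₀'(0)` with frozen
derivative is a `1 / 2`-contraction of the closed disc of radius `η`, and it moves the centre by at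
most `η / 2`, so that it maps the disc into itself. -/
def ContractsNear (F₀ : BoundedAnalytic ε) (η κ : ℝ) : Prop :=
  ∀ G : BoundedAnalytic ε, ‖G - F₀‖ ≤ κ →
    ‖discEval G 0 / deriv (discEval F₀) 0‖ ≤ η / 2 ∧
    ∀ y ∈ closedBall (0 : ℂ) η, ∀ z ∈ closedBall (0 : ℂ) η,
      ‖(y - discEval G y / deriv (discEval F₀) 0) -
        (z - discEval G z / deriv (discEval F₀) 0)‖ ≤ 1 / 2 * ‖y - z‖

theorem exists_contractsNear (hε : 0 < ε) (F₀ : BoundedAnalytic ε) (h0 : discEval F₀ 0 = 0)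
    (h1 : deriv (discEval F₀) 0 ≠ 0) :
    ∃ η κ : ℝ, 0 < η ∧ 0 < κ ∧ η < ε / 2 ∧ ContractsNear F₀ η κ := by
  set a := deriv (discEval F₀) 0 with ha
  have ha0 : 0 < ‖a‖ := norm_pos_iff.2 h1
  have hcont : ContinuousAt (deriv (discEval F₀)) 0 :=
    (((differentiableOn_discEval F₀).deriv isOpen_ball).differentiableAt
      (ball_mem_nhds 0 hε)).continuousAt
  obtain ⟨δ, hδ, hδ'⟩ := Metric.continuousAt_iff.1 hcont (‖a‖ / 4) (by positivity)
  set η := min (δ / 2) (ε / 4) with hη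
  have hη0 : 0 < η := by positivity
  have hηδ : η < δ := (min_le_left _ _).trans_lt (by linarith)
  have hηε : η < ε / 2 := (min_le_right _ _).trans_lt (by linarith)
  refine ⟨η, min (ε / 4 * (‖a‖ / 4)) (‖a‖ * (η / 2)), hη0, by positivity, hηε, fun G hG => ⟨?_, ?_⟩⟩
  · have h2 : ‖discEval G 0‖ ≤ ‖a‖ * (η / 2) := by
      have := norm_discEval_le (G - F₀) 0
      rw [discEval_sub, h0, sub_zero] at this
      exact this.trans (hG.trans (min_le_right _ _))
    rw [norm_div, div_le_iff₀ ha0]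
    linarith
  · intro y hy z hz
    have hsub : closedBall (0 : ℂ) η ⊆ ball 0 (ε / 2) := closedBall_subset_ball hηε
    have hsub' : closedBall (0 : ℂ) η ⊆ ball 0 ε :=
      closedBall_subset_ball (hηε.trans (by linarith))
    have hd : ∀ x ∈ closedBall (0 : ℂ) η, HasDerivAt (fun y => y - discEval G y / a)
        (1 - deriv (discEval G) x / a) x := fun x hx =>
      (hasDerivAt_id x).sub ((differentiableAt_discEval G (hsub' hx)).hasDerivAt.div_const a)
    refine Convex.norm_image_sub_le_of_norm_deriv_le (f := fun y => y - discEval G y / a)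
      (fun x hx => (hd x hx).differentiableAt) (fun x hx => ?_) (convex_closedBall 0 η) hz hy
    rw [(hd x hx).deriv]
    have e : 1 - deriv (discEval G) x / a =
        -((deriv (discEval F₀) x - a) + deriv (discEval (G - F₀)) x) / a := by
      have : deriv (discEval (G - F₀)) x = deriv (discEval G) x - deriv (discEval F₀) x := by
        have h : discEval (G - F₀) = discEval G - discEval F₀ := funext fun y => discEval_sub G F₀ y
        rw [h, deriv_sub (differentiableAt_discEval G (hsub' hx))
          (differentiableAt_discEval F₀ (hsub' hx))]
      rw [this]
      field_simp
      ring
    rw [e, norm_div, norm_neg, div_le_iff₀ ha0]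
    have b1 : ‖deriv (discEval F₀) x - a‖ ≤ ‖a‖ / 4 := by
      rw [← dist_eq_norm]
      exact (hδ' ((mem_closedBall.1 hx).trans_lt hηδ)).le
    have b2 : ‖deriv (discEval (G - F₀)) x‖ ≤ ‖a‖ / 4 := by
      refine (norm_deriv_discEval_le hε _ (hsub hx)).trans ?_
      rw [div_le_iff₀ (by positivity)]
      have := hG.trans (min_le_left _ _)
      linarith
    linarith [norm_add_le (deriv (discEval F₀) x - a) (deriv (discEval (G - F₀)) x)]

/-- If `y ↦ y - G y / a` is a `1 / 2`-contraction, then `G` expands distances by at least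
`‖a‖ / 2`. -/
theorem norm_sub_le_of_contraction {a y z p q : ℂ}
    (h : ‖(y - p / a) - (z - q / a)‖ ≤ 1 / 2 * ‖y - z‖) : ‖y - z‖ ≤ 2 / ‖a‖ * ‖p - q‖ := by
  have e : y - z = ((y - p / a) - (z - q / a)) + (p - q) / a := by ring
  have h2 : ‖y - z‖ ≤ ‖(y - p / a) - (z - q / a)‖ + ‖p - q‖ / ‖a‖ := by
    conv_lhs => rw [e]
    exact (norm_add_le _ _).trans (by rw [norm_div])
  have : 2 / ‖a‖ * ‖p - q‖ = 2 * (‖p - q‖ / ‖a‖) := by ring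
  linarith

/-- A holomorphic family `Ψ` of functions for which `y ↦ y - Ψ u y / a` is a contraction of a
fixed disc has a holomorphic family of zeros, the uniform limit of the Picard iterates. -/
theorem exists_differentiableOn_zero (hε : 0 < ε) {a : ℂ} (ha : a ≠ 0) {η : ℝ}
    (hη : 0 < η) (hηε : η < ε / 2) {U : Set ℂ} (hU : IsOpen U) {Ψ : ℂ → BoundedAnalytic ε}
    (hΨ : DifferentiableOn ℂ Ψ U)
    (hΨ0 : ∀ u ∈ U, ‖discEval (Ψ u) 0 / a‖ ≤ η / 2)
    (hΨ1 : ∀ u ∈ U, ∀ y ∈ closedBall (0 : ℂ) η, ∀ z ∈ closedBall (0 : ℂ) η,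
      ‖(y - discEval (Ψ u) y / a) - (z - discEval (Ψ u) z / a)‖ ≤ 1 / 2 * ‖y - z‖) :
    ∃ φ : ℂ → ℂ, DifferentiableOn ℂ φ U ∧
      ∀ u ∈ U, φ u ∈ closedBall (0 : ℂ) η ∧ discEval (Ψ u) (φ u) = 0 := by
  set T : ℂ → ℂ → ℂ := fun u y => y - discEval (Ψ u) y / a with hT
  set s : ℕ → ℂ → ℂ := fun n u => (T u)^[n] 0 with hs
  have hs0 : ∀ u, s 0 u = 0 := fun u => rfl
  have hss : ∀ n u, s (n + 1) u = T u (s n u) := fun n u =>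
    Function.iterate_succ_apply' _ _ _
  have h0mem : (0 : ℂ) ∈ closedBall (0 : ℂ) η := mem_closedBall_self hη.le
  have hT0 : ∀ u ∈ U, ‖T u 0‖ ≤ η / 2 := fun u hu => by simpa [hT] using hΨ0 u hu
  have hmem : ∀ n, ∀ u ∈ U, s n u ∈ closedBall (0 : ℂ) η := by
    intro n u hu
    induction n with
    | zero => exact h0mem
    | succ n ih =>
      rw [hss, mem_closedBall_zero_iff]
      have h1 := hΨ1 u hu _ ih 0 h0mem
      have h2 := hT0 u hu
      rw [mem_closedBall_zero_iff] at ih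
      have e : T u (s n u) = (T u (s n u) - T u 0) + T u 0 := by ring
      rw [e]
      refine (norm_add_le _ _).trans ?_
      rw [sub_zero] at h1
      have : ‖T u (s n u) - T u 0‖ ≤ 1 / 2 * ‖s n u‖ := h1
      linarith
  have hgeo : ∀ u ∈ U, ∀ n, dist (s n u) (s (n + 1) u) ≤ η / 2 * (1 / 2) ^ n := by
    intro u hu n
    induction n with
    | zero =>
      rw [hss, hs0, dist_zero_left]
      simpa using hT0 u hu
    | succ n ih =>
      rw [hss n u, hss (n + 1) u, dist_eq_norm, pow_succ]
      have h1 := hΨ1 u hu _ (hmem n u hu) _ (hmem (n + 1) u hu)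
      rw [dist_eq_norm] at ih
      have h2 : ‖T u (s n u) - T u (s (n + 1) u)‖ ≤ 1 / 2 * ‖s n u - s (n + 1) u‖ := h1
      linarith
  have hlim : ∀ u ∈ U, ∃ y, Tendsto (fun n => s n u) atTop (𝓝 y) := fun u hu =>
    cauchySeq_tendsto_of_complete (cauchySeq_of_le_geometric _ _ (by norm_num) (hgeo u hu))
  choose! φ hφ using hlim
  have hunif : TendstoUniformlyOn s φ atTop U := by
    rw [Metric.tendstoUniformlyOn_iff]
    intro e he
    have h1 : Tendsto (fun n : ℕ => η / 2 * (1 / 2 : ℝ) ^ n / (1 - 1 / 2)) atTop (𝓝 0) := by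
      have := ((tendsto_pow_atTop_nhds_zero_of_lt_one (by norm_num : (0 : ℝ) ≤ 1 / 2)
        (by norm_num)).const_mul (η / 2)).div_const (1 - 1 / 2 : ℝ)
      simpa using this
    filter_upwards [h1.eventually_lt_const he] with n hn u hu
    rw [dist_comm]
    exact (dist_le_of_le_geometric_of_tendsto _ _ (by norm_num) (hgeo u hu) (hφ u hu) n).trans_lt hn
  have hdiff : ∀ n, DifferentiableOn ℂ (s n) U := by
    intro n
    induction n with
    | zero => exact differentiableOn_const 0
    | succ n ih =>
      intro u hu
      have hat : DifferentiableAt ℂ (s n) u := ih.differentiableAt (hU.mem_nhds hu)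
      have h1 := DifferentiableAt.discEval_comp hε (hΨ.differentiableAt (hU.mem_nhds hu)) hat
        (closedBall_subset_ball hηε (hmem n u hu))
      have e : s (n + 1) = fun u => s n u - discEval (Ψ u) (s n u) / a := funext fun u => hss n u
      rw [e]
      exact (hat.sub (h1.div_const a)).differentiableWithinAt
  refine ⟨φ, hunif.tendstoLocallyUniformlyOn.differentiableOn (Eventually.of_forall hdiff) hU,
    fun u hu => ?_⟩
  have hφmem : φ u ∈ closedBall (0 : ℂ) η :=
    isClosed_closedBall.mem_of_tendsto (hφ u hu) (Eventually.of_forall fun n => hmem n u hu)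
  refine ⟨hφmem, ?_⟩
  have hcont : ContinuousAt (T u) (φ u) :=
    continuousAt_id.sub ((differentiableAt_discEval (Ψ u) (closedBall_subset_ball
      (hηε.trans (by linarith)) hφmem)).continuousAt.div_const a)
  have l1 : Tendsto (fun n => s (n + 1) u) atTop (𝓝 (T u (φ u))) := by
    have := hcont.tendsto.comp (hφ u hu)
    refine this.congr fun n => ?_
    rw [hss]; rfl
  have l2 : Tendsto (fun n => s (n + 1) u) atTop (𝓝 (φ u)) :=
    (tendsto_add_atTop_iff_nat 1).2 (hφ u hu)
  have hfix : φ u - discEval (Ψ u) (φ u) / a = φ u := tendsto_nhds_unique l1 l2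
  rw [sub_eq_self, div_eq_zero_iff] at hfix
  exact hfix.resolve_right ha

end Zero

/-! ### Taylor expansions and formal substitution -/

section Taylor

open Asymptotics Topology Filter

/-- The germ `f` at `0` has the expansion `φ` up to an error `O(x ^ N)`. The expansion is witnessed
by any polynomial congruent to `φ` modulo `X ^ N`. -/
def AgreesToOrder (N : ℕ) (f : ℂ → ℂ) (φ : PowerSeries ℂ) : Prop :=
  ∃ p : Polynomial ℂ, PowerSeries.X ^ N ∣ φ - (p : PowerSeries ℂ) ∧
    (fun x => f x - p.eval x) =O[𝓝 0] fun x : ℂ => x ^ N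

variable {N : ℕ} {f f' : ℂ → ℂ} {φ φ' : PowerSeries ℂ}

theorem isBigO_polynomial_one (p : Polynomial ℂ) :
    (fun x => p.eval x) =O[𝓝 0] fun _ : ℂ => (1 : ℂ) :=
  p.continuous.continuousAt.isBigO_one ℂ

theorem AgreesToOrder.congr (h : AgreesToOrder N f φ)
    (hf : (fun x => f' x - f x) =O[𝓝 0] fun x : ℂ => x ^ N) (hφ : PowerSeries.X ^ N ∣ φ' - φ) :
    AgreesToOrder N f' φ' := by
  obtain ⟨p, hp, hfp⟩ := h
  refine ⟨p, ?_, ?_⟩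
  · simpa using dvd_add hφ hp
  · simpa using hf.add hfp

theorem AgreesToOrder.add (h : AgreesToOrder N f φ) (h' : AgreesToOrder N f' φ') :
    AgreesToOrder N (fun x => f x + f' x) (φ + φ') := by
  obtain ⟨p, hp, hfp⟩ := h
  obtain ⟨q, hq, hfq⟩ := h'
  refine ⟨p + q, ?_, ?_⟩
  · have e : φ + φ' - ((p + q : Polynomial ℂ) : PowerSeries ℂ) = (φ - p) + (φ' - q) := by
      push_cast; ring
    rw [e]; exact dvd_add hp hq
  · refine (hfp.add hfq).congr_left fun x => ?_
    rw [Polynomial.eval_add]; ring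

theorem AgreesToOrder.mul (h : AgreesToOrder N f φ) (h' : AgreesToOrder N f' φ') :
    AgreesToOrder N (fun x => f x * f' x) (φ * φ') := by
  obtain ⟨p, hp, hfp⟩ := h
  obtain ⟨q, hq, hfq⟩ := h'
  refine ⟨p * q, ?_, ?_⟩
  · have e : φ * φ' - ((p * q : Polynomial ℂ) : PowerSeries ℂ) =
        (φ - p) * φ' + (φ' - q) * p := by
      push_cast; ring
    rw [e]; exact dvd_add (hp.mul_right _) (hq.mul_right _)
  · have hX : (fun x : ℂ => x ^ N) =O[𝓝 0] fun _ : ℂ => (1 : ℂ) :=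
      (continuous_pow N).continuousAt.isBigO_one ℂ
    have h1 := hfp.mul (hfq.trans hX)
    have h2 := hfp.mul (isBigO_polynomial_one q)
    have h3 := hfq.mul (isBigO_polynomial_one p)
    simp only [mul_one] at h1 h2 h3
    refine ((h1.add h2).add h3).congr_left fun x => ?_
    rw [Polynomial.eval_mul]; ring

theorem agreesToOrder_polynomial (N : ℕ) (p : Polynomial ℂ) :
    AgreesToOrder N (fun x => p.eval x) p :=
  ⟨p, by simp, by simpa using isBigO_zero _ _⟩

theorem agreesToOrder_const (N : ℕ) (c : ℂ) :
    AgreesToOrder N (fun _ => c) (PowerSeries.C c) := by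
  simpa using agreesToOrder_polynomial N (Polynomial.C c)

theorem agreesToOrder_pow_self (N j : ℕ) :
    AgreesToOrder N (fun x => x ^ j) (PowerSeries.X ^ j) := by
  simpa using agreesToOrder_polynomial N (Polynomial.X ^ j)

theorem AgreesToOrder.pow (h : AgreesToOrder N f φ) (k : ℕ) :
    AgreesToOrder N (fun x => f x ^ k) (φ ^ k) := by
  induction k with
  | zero => simpa using agreesToOrder_const N 1
  | succ k ih => simpa only [pow_succ] using ih.mul h

theorem AgreesToOrder.sum {ι : Type*} (s : Finset ι) {f : ι → ℂ → ℂ} {φ : ι → PowerSeries ℂ}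
    (h : ∀ i, AgreesToOrder N (f i) (φ i)) :
    AgreesToOrder N (fun x => ∑ i ∈ s, f i x) (∑ i ∈ s, φ i) := by
  classical
  induction s using Finset.induction_on with
  | empty => simpa using agreesToOrder_const N 0
  | insert i s hi ih =>
    simp only [Finset.sum_insert hi]
    exact (h i).add ih

/-- The Taylor series at `0` of a function on `ℂ`. -/
noncomputable def taylorAtZero (f : ℂ → ℂ) : PowerSeries ℂ :=
  PowerSeries.mk fun k => iteratedDeriv k f 0 / (k.factorial : ℂ)

theorem isBigO_sub_taylorAtZero (hf : AnalyticAt ℂ f 0) (N : ℕ) :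
    (fun x => f x - ∑ k ∈ Finset.range N, PowerSeries.coeff k (taylorAtZero f) * x ^ k)
      =O[𝓝 0] fun x : ℂ => x ^ N := by
  have h := hf.hasFPowerSeriesAt.isBigO_sub_partialSum_pow N
  have h2 : (fun x : ℂ => ‖x‖ ^ N) = fun x => ‖x ^ N‖ := by funext x; rw [norm_pow]
  rw [h2, isBigO_norm_right] at h
  refine h.congr_left fun x => ?_
  simp [FormalMultilinearSeries.partialSum, taylorAtZero, mul_comm]

theorem agreesToOrder_taylorAtZero (hf : AnalyticAt ℂ f 0) (N : ℕ) :
    AgreesToOrder N f (taylorAtZero f) := by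
  refine ⟨∑ k ∈ Finset.range N, Polynomial.C (PowerSeries.coeff k (taylorAtZero f)) *
    Polynomial.X ^ k, ?_, ?_⟩
  · rw [PowerSeries.X_pow_dvd_iff]
    intro m hm
    rw [map_sub, Polynomial.coeff_coe, Polynomial.finsetSum_coeff]
    simp [Polynomial.coeff_C_mul, Polynomial.coeff_X_pow, hm]
  · simpa [Polynomial.eval_finsetSum] using isBigO_sub_taylorAtZero hf N

theorem X_pow_dvd_subst_sub_sum {ψ : PowerSeries ℂ} (hψ : PowerSeries.constantCoeff ψ = 0)
    (a : PowerSeries ℂ) (N : ℕ) :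
    PowerSeries.X ^ N ∣ (PowerSeries.subst ψ a : PowerSeries ℂ) -
      ∑ k ∈ Finset.range N, PowerSeries.C (PowerSeries.coeff k a) * ψ ^ k := by
  rw [PowerSeries.X_pow_dvd_iff]
  intro m hm
  rw [map_sub, PowerSeries.coeff_subst' (PowerSeries.HasSubst.of_constantCoeff_zero' hψ),
    map_sum, finsum_eq_sum_of_support_subset (s := Finset.range N), sub_eq_zero]
  · exact Finset.sum_congr rfl fun k _ => by rw [PowerSeries.coeff_C_mul, smul_eq_mul]
  · intro d hd
    rw [Finset.coe_range, Set.mem_Iio]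
    by_contra hdN
    refine hd ?_
    have h1 : PowerSeries.X ^ d ∣ ψ ^ d := pow_dvd_pow_of_dvd (PowerSeries.X_dvd_iff.2 hψ) d
    simp only [PowerSeries.X_pow_dvd_iff.1 h1 m (by omega), smul_zero]

/-- The expansion of a composition is the formal substitution of the expansions. -/
theorem AgreesToOrder.comp {h : ℂ → ℂ} {ψ : PowerSeries ℂ} (hf : AnalyticAt ℂ f 0)
    (hh : AgreesToOrder N h ψ) (hhd : DifferentiableAt ℂ h 0) (h0 : h 0 = 0)
    (hψ : PowerSeries.constantCoeff ψ = 0) :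
    AgreesToOrder N (fun x => f (h x)) (PowerSeries.subst ψ (taylorAtZero f)) := by
  have hsum : AgreesToOrder N
      (fun x => ∑ k ∈ Finset.range N, PowerSeries.coeff k (taylorAtZero f) * h x ^ k)
      (∑ k ∈ Finset.range N, PowerSeries.C (PowerSeries.coeff k (taylorAtZero f)) * ψ ^ k) :=
    AgreesToOrder.sum _ fun k => (agreesToOrder_const N _).mul (hh.pow k)
  refine hsum.congr ?_ (X_pow_dvd_subst_sub_sum hψ _ N)
  have ht : Tendsto h (𝓝 0) (𝓝 0) := by
    have := hhd.continuousAt.tendsto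
    rwa [h0] at this
  have h1 := (isBigO_sub_taylorAtZero hf N).comp_tendsto ht
  have h2 : h =O[𝓝 0] fun x : ℂ => x := by simpa [h0] using hhd.isBigO_sub
  exact h1.trans (h2.pow N)

theorem X_pow_dvd_of_isBigO {p : Polynomial ℂ}
    (hp : (fun x => p.eval x) =O[𝓝 0] fun x : ℂ => x ^ N) : Polynomial.X ^ N ∣ p := by
  by_cases hp0 : p = 0
  · simp [hp0]
  obtain ⟨q, hpq, hq⟩ := p.exists_eq_pow_rootMultiplicity_mul_and_not_dvd hp0 0
  set k := p.rootMultiplicity 0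
  rw [map_zero, sub_zero] at hpq hq
  rw [Polynomial.X_dvd_iff, Polynomial.coeff_zero_eq_eval_zero] at hq
  have hNk : N ≤ k := by
    by_contra! hlt
    have h1 : (fun _ : ℂ => (1 : ℂ)) =O[𝓝 0] fun x => q.eval x :=
      (isBigO_const_left_iff_pos_le_norm one_ne_zero).2 ⟨‖q.eval 0‖ / 2, by positivity,
        (q.continuous.continuousAt.norm.eventually_const_lt
          (half_lt_self (norm_pos_iff.2 hq))).mono fun _ hx => hx.le⟩
    have h2 : (fun x : ℂ => x ^ k) =O[𝓝 0] fun x => p.eval x := by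
      have := (isBigO_refl (fun x : ℂ => x ^ k) (𝓝 0)).mul h1
      rw [hpq]
      simpa using this
    have h3 : (fun x : ℂ => x ^ k) =o[𝓝 0] fun x : ℂ => x ^ k :=
      (h2.trans hp).trans_isLittleO (isLittleO_pow_pow hlt)
    refine isLittleO_irrefl ?_ (h3.mono (nhdsWithin_le_nhds (s := {0}ᶜ)))
    refine Eventually.frequently ?_
    filter_upwards [self_mem_nhdsWithin] with x hx
    exact pow_ne_zero k hx
  rw [hpq]
  exact (pow_dvd_pow _ hNk).mul_right _

theorem AgreesToOrder.X_pow_dvd (h : AgreesToOrder N f φ) (hf : ∀ᶠ x in 𝓝 0, f x = 0) :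
    PowerSeries.X ^ N ∣ φ := by
  obtain ⟨p, hp, hfp⟩ := h
  have h1 : (fun x => p.eval x) =O[𝓝 0] fun x : ℂ => x ^ N := by
    refine hfp.neg_left.congr' ?_ EventuallyEq.rfl
    filter_upwards [hf] with x hx
    rw [hx]; ring
  obtain ⟨q, hq⟩ := X_pow_dvd_of_isBigO h1
  have h2 : PowerSeries.X ^ N ∣ (p : PowerSeries ℂ) := ⟨q, by rw [hq]; push_cast; rfl⟩
  simpa using dvd_add hp h2

theorem X_pow_dvd_twoVarSubst_sub_sum (a : ℕ → PowerSeries ℂ) (g : PowerSeries ℂ) (N : ℕ) :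
    PowerSeries.X ^ N ∣ twoVarSubst a g -
      ∑ j ∈ Finset.range N, PowerSeries.X ^ j * (PowerSeries.subst g (a j) : PowerSeries ℂ) := by
  rw [PowerSeries.X_pow_dvd_iff]
  intro m hm
  rw [map_sub, twoVarSubst, PowerSeries.coeff_mk, map_sum,
    Finset.Nat.sum_antidiagonal_eq_sum_range_succ_mk, sub_eq_zero]
  simp only [PowerSeries.coeff_X_pow_mul']
  rw [← Finset.sum_subset (Finset.range_subset_range.2 (Nat.succ_le_of_lt hm))]
  · refine Finset.sum_congr rfl fun j hj => ?_
    rw [Finset.mem_range] at hj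
    rw [if_pos (by omega)]
  · intro j _ hj
    rw [Finset.mem_range] at hj
    rw [if_neg (by omega)]

/-- An analytic solution of the truncated equation solves the formal equation modulo `X ^ N`. -/
theorem X_pow_dvd_formalSubst_taylorAtZero {ε : ℝ} (hε : 0 < ε) (F : ℕ → BoundedAnalytic ε)
    {h : ℂ → ℂ} (hh : AnalyticAt ℂ h 0) (h0 : h 0 = 0)
    (heq : ∀ᶠ x in 𝓝 0, ∑ j ∈ Finset.range N, x ^ j * discEval (F j) (h x) = 0) :
    PowerSeries.X ^ N ∣ formalSubst F (taylorAtZero h) := by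
  have hc : PowerSeries.constantCoeff (taylorAtZero h) = 0 := by
    rw [← PowerSeries.coeff_zero_eq_constantCoeff_apply]
    simp [taylorAtZero, h0]
  have hF : ∀ j, AnalyticAt ℂ (discEval (F j)) 0 := fun j =>
    (differentiableOn_discEval (F j)).analyticAt (Metric.ball_mem_nhds 0 hε)
  have hs : AgreesToOrder N (fun x => ∑ j ∈ Finset.range N, x ^ j * discEval (F j) (h x))
      (∑ j ∈ Finset.range N, PowerSeries.X ^ j *
        (PowerSeries.subst (taylorAtZero h) (taylorSeries (F j)) : PowerSeries ℂ)) :=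
    AgreesToOrder.sum _ fun j => (agreesToOrder_pow_self N j).mul
      ((agreesToOrder_taylorAtZero hh N).comp (hF j) hh.differentiableAt h0 hc)
  have h1 := X_pow_dvd_twoVarSubst_sub_sum (fun j => taylorSeries (F j)) (taylorAtZero h) N
  rw [formalSubst_eq_twoVarSubst]
  simpa using dvd_add h1 (hs.X_pow_dvd heq)

/-- Cauchy's estimates for the Taylor coefficients at `0`. -/
theorem norm_coeff_taylorAtZero_mul_pow_le {R r η : ℝ} (hf : DifferentiableOn ℂ f (Metric.ball 0 R))
    (hb : ∀ x ∈ Metric.ball (0 : ℂ) R, ‖f x‖ ≤ η) (hr : 0 < r) (hrR : r < R) (n : ℕ) :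
    ‖PowerSeries.coeff n (taylorAtZero f)‖ * r ^ n ≤ η := by
  have hsub : Metric.closedBall (0 : ℂ) r ⊆ Metric.ball 0 R := Metric.closedBall_subset_ball hrR
  have h := Complex.norm_iteratedDeriv_le_of_forall_mem_sphere_norm_le n hr
    ((hf.mono (Metric.closure_ball_subset_closedBall.trans hsub)).diffContOnCl)
    (fun z hz => hb z (hsub (Metric.sphere_subset_closedBall hz)))
  have hn : (0 : ℝ) < n.factorial := by exact_mod_cast n.factorial_pos
  rw [taylorAtZero, PowerSeries.coeff_mk, norm_div, Complex.norm_natCast,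
    ← le_div_iff₀ (by positivity), div_le_iff₀ hn]
  exact h.trans (le_of_eq (by ring))

theorem norm_sub_taylorAtZero_le {R r η : ℝ} (hf : DifferentiableOn ℂ f (Metric.ball 0 R))
    (hb : ∀ x ∈ Metric.ball (0 : ℂ) R, ‖f x‖ ≤ η) (hr : 0 < r) (hrR : r < R) {x : ℂ}
    (hx : ‖x‖ ≤ r / 2) (N : ℕ) :
    ‖f x - ∑ n ∈ Finset.range N, x ^ n • PowerSeries.coeff n (taylorAtZero f)‖ ≤
      2 * η * (‖x‖ / r) ^ N := by
  have hxR : x ∈ Metric.ball (0 : ℂ) R := by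
    rw [mem_ball_zero_iff]; linarith
  have hη : 0 ≤ η := (norm_nonneg _).trans (hb x hxR)
  have hs : HasSum (fun n => x ^ n • PowerSeries.coeff n (taylorAtZero f)) (f x) := by
    refine (Complex.hasSum_taylorSeries_on_ball hf hxR).congr_fun ?_
    intro n
    simp only [taylorAtZero, PowerSeries.coeff_mk, sub_zero, smul_eq_mul]
    ring
  have hs' := (hasSum_nat_add_iff' N).2 hs
  have hg : HasSum (fun n : ℕ => η * (‖x‖ / r) ^ N * (1 / 2) ^ n) (η * (‖x‖ / r) ^ N * 2) :=
    hasSum_geometric_two.mul_left _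
  refine (hs'.norm_le_of_bounded hg fun n => ?_).trans (le_of_eq (by ring))
  have h1 := norm_coeff_taylorAtZero_mul_pow_le hf hb hr hrR (n + N)
  have h2 : ‖x‖ / r ≤ 1 / 2 := by rw [div_le_iff₀ hr]; linarith
  have h3 : (‖x‖ / r) ^ n ≤ (1 / 2) ^ n := by gcongr
  calc ‖x ^ (n + N) • PowerSeries.coeff (n + N) (taylorAtZero f)‖
      = (‖PowerSeries.coeff (n + N) (taylorAtZero f)‖ * r ^ (n + N)) * (‖x‖ / r) ^ (n + N) := by
        rw [norm_smul, norm_pow, div_pow]; field_simp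
    _ ≤ η * (‖x‖ / r) ^ (n + N) := by gcongr
    _ = η * (‖x‖ / r) ^ N * (‖x‖ / r) ^ n := by ring
    _ ≤ η * (‖x‖ / r) ^ N * (1 / 2) ^ n := by gcongr

end Taylor

/-! ### Gevrey estimates -/

section Gevrey

open Metric

/-- By logarithmic convexity of `Γ` and `Γ 1 = 1`, the numbers `Γ(1 + s j) ^ (1 / j)` increase
with `j`. -/
theorem Gamma_one_add_mul_le_rpow {s : ℝ} (hs : 0 < s) {j N : ℕ} (hj : 0 < j) (hjN : j ≤ N) :
    Real.Gamma (1 + s * j) ≤ (Real.Gamma (1 + s * N) ^ (1 / (N : ℝ))) ^ j := by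
  have hN : (0 : ℝ) < N := by exact_mod_cast hj.trans_le hjN
  have hj' : (0 : ℝ) < j := by exact_mod_cast hj
  have hpos : 0 < Real.Gamma (1 + s * N) := Real.Gamma_pos_of_pos (by positivity)
  rw [← Real.rpow_natCast, ← Real.rpow_mul hpos.le]
  rcases hjN.eq_or_lt with rfl | hlt
  · rw [one_div_mul_cancel hN.ne', Real.rpow_one]
  · have hlt' : (j : ℝ) < N := by exact_mod_cast hlt
    have h := Real.Gamma_mul_add_mul_le_rpow_Gamma_mul_rpow_Gamma (s := 1) (t := 1 + s * N)
      (a := 1 - j / N) (b := j / N) one_pos (by positivity)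
      (by rw [sub_pos, div_lt_one hN]; exact hlt') (by positivity) (by ring)
    rw [Real.Gamma_one, Real.one_rpow, one_mul] at h
    have e : (1 - (j : ℝ) / N) * 1 + j / N * (1 + s * N) = 1 + s * j := by field_simp; ring
    rw [e] at h
    rwa [one_div, inv_mul_eq_div]

theorem rpow_one_div_natCast_pow {x : ℝ} (hx : 0 ≤ x) {N : ℕ} (hN : 0 < N) :
    (x ^ (1 / (N : ℝ))) ^ N = x := by
  rw [one_div]
  exact Real.rpow_inv_natCast_pow hx hN.ne'

theorem norm_sum_pow_smul_sub_le {E : Type*} [NormedAddCommGroup E] [NormedSpace ℂ E]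
    {c : ℕ → E} {N : ℕ} (hN : 0 < N) {C t : ℝ} (hC : 0 ≤ C) (ht : 0 ≤ t) (ht2 : t ≤ 1 / 2) {x : ℂ}
    (hc : ∀ j, 0 < j → j < N → ‖x ^ j • c j‖ ≤ C * t ^ j) :
    ‖∑ j ∈ Finset.range N, x ^ j • c j - c 0‖ ≤ 2 * C * t := by
  obtain ⟨M, rfl⟩ := Nat.exists_eq_succ_of_ne_zero hN.ne'
  rw [Nat.succ_eq_add_one, Finset.sum_range_succ', pow_zero, one_smul, add_sub_cancel_right]
  calc ‖∑ j ∈ Finset.range M, x ^ (j + 1) • c (j + 1)‖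
      ≤ ∑ j ∈ Finset.range M, C * t * (1 / 2) ^ j := by
        refine norm_sum_le_of_le _ fun j hj => ?_
        rw [Finset.mem_range] at hj
        refine (hc (j + 1) j.succ_pos (by omega)).trans ?_
        have : t ^ j ≤ (1 / 2) ^ j := by gcongr
        rw [pow_succ']
        calc C * (t * t ^ j) = C * t * t ^ j := by ring
          _ ≤ C * t * (1 / 2) ^ j := by gcongr
    _ = C * t * ∑ j ∈ Finset.range M, (1 / 2 : ℝ) ^ j := by rw [Finset.mul_sum]
    _ ≤ C * t * 2 := by
        gcongr
        exact sum_geometric_two_le M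
    _ = 2 * C * t := by ring

/-- The coefficients of a Gevrey asymptotic expansion satisfy the Gevrey bounds with the same
constants. -/
theorem norm_coeff_le_of_gevrey {E : Type*} [NormedAddCommGroup E] [NormedSpace ℂ E]
    {s a b r C A : ℝ} (hab : a < b) (hr : 0 < r) {f : ℂ → E} {c : ℕ → E}
    (h : ∀ N : ℕ, 0 < N → ∀ w ∈ sector a b r,
      ‖f w - ∑ n ∈ Finset.range N, Complex.exp w ^ n • c n‖ ≤
        C * ‖Complex.exp w‖ ^ N * A ^ N * Real.Gamma (1 + s * N)) {j : ℕ} (hj : 0 < j) :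
    ‖c j‖ ≤ C * A ^ j * Real.Gamma (1 + s * j) := by
  set K := C * A ^ (j + 1) * Real.Gamma (1 + s * (j + 1 : ℕ)) with hK
  have key : ∀ t ∈ Set.Ioo 0 r, ‖c j‖ ≤ C * A ^ j * Real.Gamma (1 + s * j) + K * t := by
    intro t ht
    have hexp : ‖Complex.exp (Real.log t + ((a + b) / 2 : ℝ) * Complex.I)‖ = t := by
      rw [Complex.norm_exp]
      simp [Real.exp_log ht.1]
    set w : ℂ := Real.log t + ((a + b) / 2 : ℝ) * Complex.I with hw
    have him : w.im = (a + b) / 2 := by simp [hw]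
    have hmem : w ∈ sector a b r :=
      ⟨by rw [him]; linarith, by rw [him]; linarith, by rw [hexp]; exact ht.2⟩
    have h1 := h j hj w hmem
    have h2 := h (j + 1) j.succ_pos w hmem
    rw [Finset.sum_range_succ] at h2
    rw [hexp] at h1 h2
    have e : Complex.exp w ^ j • c j =
        (f w - ∑ n ∈ Finset.range j, Complex.exp w ^ n • c n) -
        (f w - (∑ n ∈ Finset.range j, Complex.exp w ^ n • c n + Complex.exp w ^ j • c j)) := by
      abel
    have h3 : t ^ j * ‖c j‖ ≤ t ^ j * (C * A ^ j * Real.Gamma (1 + s * j) + K * t) := by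
      have : ‖Complex.exp w ^ j • c j‖ = t ^ j * ‖c j‖ := by rw [norm_smul, norm_pow, hexp]
      rw [← this, e]
      refine (norm_sub_le _ _).trans ((add_le_add h1 h2).trans (le_of_eq ?_))
      rw [hK]; ring
    exact le_of_mul_le_mul_left h3 (pow_pos ht.1 j)
  have hlim : Filter.Tendsto (fun t : ℝ => C * A ^ j * Real.Gamma (1 + s * j) + K * t)
      (nhdsWithin 0 (Set.Ioi 0)) (nhds (C * A ^ j * Real.Gamma (1 + s * j) + K * 0)) :=
    ((continuous_const.add (continuous_const.mul continuous_id)).tendsto 0).mono_left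
      nhdsWithin_le_nhds
  rw [mul_zero, add_zero] at hlim
  exact ge_of_tendsto hlim (Filter.eventually_of_mem (Ioo_mem_nhdsGT hr) key)

/-- Analytic solutions of the truncated equation. They live on a disc whose radius shrinks like
`Γ(1 + s N) ^ (-1 / N)`, and their Taylor coefficients of order less than `N` are those of the
formal solution. -/
theorem exists_solution_of_truncation {ε s C A η κ c : ℝ} (hε : 0 < ε) (hs : 0 < s) (hC : 0 < C)
    (hA : 0 < A) (hη : 0 < η) (hηε : η < ε / 2) (hc : 0 < c) (hcA : A * c ≤ 1 / 2)
    (hcκ : 2 * C * (A * c) ≤ κ) {F : ℕ → BoundedAnalytic ε} (hF0 : discEval (F 0) 0 = 0)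
    (hF1 : deriv (discEval (F 0)) 0 ≠ 0)
    (hFj : ∀ j : ℕ, 0 < j → ‖F j‖ ≤ C * A ^ j * Real.Gamma (1 + s * j))
    (hcontr : ContractsNear (F 0) η κ)
    {g : PowerSeries ℂ} (hg : PowerSeries.constantCoeff g = 0) (hFg : formalSubst F g = 0)
    {N : ℕ} (hN : 0 < N) {R : ℝ} (hR : R = c / Real.Gamma (1 + s * N) ^ (1 / (N : ℝ))) :
    ∃ h : ℂ → ℂ, DifferentiableOn ℂ h (ball 0 R) ∧
      (∀ x ∈ ball (0 : ℂ) R, h x ∈ closedBall (0 : ℂ) η ∧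
        discEval (∑ j ∈ Finset.range N, x ^ j • F j) (h x) = 0) ∧
      ∀ n < N, PowerSeries.coeff n (taylorAtZero h) = PowerSeries.coeff n g := by
  set Γr := Real.Gamma (1 + s * N) ^ (1 / (N : ℝ)) with hΓr
  have hΓpos : 0 < Γr := Real.rpow_pos_of_pos (Real.Gamma_pos_of_pos (by positivity)) _
  have hRpos : 0 < R := hR ▸ div_pos hc hΓpos
  set P : ℂ → BoundedAnalytic ε := fun x => ∑ j ∈ Finset.range N, x ^ j • F j with hP
  have hPd : Differentiable ℂ P :=
    Differentiable.fun_sum fun j _ => (differentiable_id.pow j).smul_const (F j)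
  have hPκ : ∀ x ∈ ball (0 : ℂ) R, ‖P x - F 0‖ ≤ κ := by
    intro x hx
    rw [mem_ball_zero_iff, hR, lt_div_iff₀ hΓpos] at hx
    have ht : A * (‖x‖ * Γr) ≤ A * c := by gcongr
    refine (norm_sum_pow_smul_sub_le hN hC.le (t := A * (‖x‖ * Γr)) (by positivity)
      (ht.trans hcA) fun j hj hjN => ?_).trans (le_trans (by gcongr) hcκ)
    rw [norm_smul, norm_pow]
    calc ‖x‖ ^ j * ‖F j‖ ≤ ‖x‖ ^ j * (C * A ^ j * Γr ^ j) := by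
          gcongr
          refine (hFj j hj).trans ?_
          gcongr
          exact Gamma_one_add_mul_le_rpow hs hj hjN.le
      _ = C * (A * (‖x‖ * Γr)) ^ j := by ring
  obtain ⟨h, hd, hz⟩ := exists_differentiableOn_zero hε hF1 hη hηε (isOpen_ball (x := (0 : ℂ)))
    hPd.differentiableOn (fun u hu => (hcontr _ (hPκ u hu)).1)
    (fun u hu => (hcontr _ (hPκ u hu)).2)
  refine ⟨h, hd, hz, fun n hn => ?_⟩
  have hmem0 : (0 : ℂ) ∈ ball (0 : ℂ) R := mem_ball_self hRpos
  have hP0 : P 0 = F 0 := by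
    rw [hP]
    simp only
    rw [Finset.sum_eq_single_of_mem 0 (Finset.mem_range.2 hN)
      (fun j _ hj => by rw [zero_pow hj, zero_smul]), pow_zero, one_smul]
  have h0 : h 0 = 0 := by
    have h1 := norm_sub_le_of_contraction ((hcontr _ (hPκ 0 hmem0)).2 _ (hz 0 hmem0).1 0
      (mem_closedBall_self hη.le))
    rw [(hz 0 hmem0).2, hP0, hF0, sub_zero, sub_zero, norm_zero, mul_zero] at h1
    exact norm_le_zero_iff.1 h1
  have hev : ∀ᶠ x in nhds (0 : ℂ), ∑ j ∈ Finset.range N, x ^ j * discEval (F j) (h x) = 0 := by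
    filter_upwards [isOpen_ball.mem_nhds hmem0] with x hx
    have h1 := (hz x hx).2
    rw [← discEvalCLM_apply, hP, map_sum] at h1
    simpa only [map_smul, discEvalCLM_apply, smul_eq_mul] using h1
  have hdvd := X_pow_dvd_formalSubst_taylorAtZero hε F
    (hd.analyticAt (isOpen_ball.mem_nhds hmem0)) h0 hev
  rw [formalSubst_eq_twoVarSubst] at hdvd hFg
  have hc0 : PowerSeries.constantCoeff (taylorAtZero h) = 0 := by
    rw [← PowerSeries.coeff_zero_eq_constantCoeff_apply]
    simp [taylorAtZero, h0]
  have h1 : PowerSeries.coeff 1 (taylorSeries (F 0)) ≠ 0 := by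
    simpa [taylorSeries] using hF1
  have h2 := PowerSeries.X_pow_dvd_iff.1
    (X_pow_dvd_sub_of_X_pow_dvd_twoVarSubst h1 hg hc0 hFg hdvd) n hn
  rw [map_sub, sub_eq_zero] at h2
  exact h2.symm

/-- For `‖x‖ > r / 2`, no cancellation between the value `y` and the partial sum is needed: each is
separately bounded in terms of powers of `2 * ‖x‖ / r ≥ 1`. The factor `N + 1 ≤ 2 ^ N` from counting
terms turns the `2` into a `4`. -/
theorem norm_sub_sum_le_of_lt {η r : ℝ} (hη : 0 ≤ η) (hr : 0 < r) {c : ℕ → ℂ} {N : ℕ}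
    (hc : ∀ n < N, ‖c n‖ * r ^ n ≤ η) {x y : ℂ} (hx : r / 2 < ‖x‖) (hy : ‖y‖ ≤ η) :
    ‖y - ∑ n ∈ Finset.range N, x ^ n • c n‖ ≤ η * (4 * ‖x‖ / r) ^ N := by
  set q := 2 * ‖x‖ / r with hq
  have hq1 : 1 ≤ q := by rw [hq, le_div_iff₀ hr]; linarith
  have hterm : ∀ n ∈ Finset.range N, ‖x ^ n • c n‖ ≤ η * q ^ N := by
    intro n hn
    rw [Finset.mem_range] at hn
    have h1 : ‖x‖ / r ≤ q := by
      rw [hq]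
      gcongr
      linarith [norm_nonneg x]
    calc ‖x ^ n • c n‖ = (‖c n‖ * r ^ n) * (‖x‖ / r) ^ n := by
          rw [norm_smul, norm_pow, div_pow]; field_simp
      _ ≤ η * q ^ n := by
          gcongr
          exact hc n hn
      _ ≤ η * q ^ N := by gcongr
  have hsum := norm_sum_le_of_le _ hterm
  rw [Finset.sum_const, Finset.card_range, nsmul_eq_mul] at hsum
  have hy' : ‖y‖ ≤ η * q ^ N := hy.trans (le_mul_of_one_le_right hη (one_le_pow₀ hq1))
  have h2 : (1 + N : ℝ) ≤ 2 ^ N := by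
    have : N + 1 ≤ 2 ^ N := Nat.lt_two_pow_self
    have : ((N + 1 : ℕ) : ℝ) ≤ (2 ^ N : ℕ) := by exact_mod_cast this
    push_cast at this
    linarith
  calc ‖y - ∑ n ∈ Finset.range N, x ^ n • c n‖ ≤ η * q ^ N + N * (η * q ^ N) :=
        (norm_sub_le _ _).trans (add_le_add hy' hsum)
    _ = (1 + N) * (η * q ^ N) := by ring
    _ ≤ 2 ^ N * (η * q ^ N) := by gcongr
    _ = η * (4 * ‖x‖ / r) ^ N := by
        rw [mul_left_comm, ← mul_pow, hq]
        congr 2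
        ring

theorem closure_sector_subset (a b r : ℝ) :
    closure (sector a b r) ⊆ {w | a ≤ w.im ∧ w.im ≤ b ∧ ‖Complex.exp w‖ ≤ r} := by
  refine closure_minimal (fun w hw => ⟨hw.1.le, hw.2.1.le, hw.2.2.le⟩) ?_
  exact (isClosed_le continuous_const Complex.continuous_im).inter
    ((isClosed_le Complex.continuous_im continuous_const).inter
      (isClosed_le (Complex.continuous_exp.norm) continuous_const))

theorem isOpen_sector (a b r : ℝ) : IsOpen (sector a b r) :=
  (isOpen_lt continuous_const Complex.continuous_im).inter
    ((isOpen_lt Complex.continuous_im continuous_const).inter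
      (isOpen_lt (Complex.continuous_exp.norm) continuous_const))

/-- The analytic implicit function theorem in one direction: the zero of `f w` near the origin is
Gevrey asymptotic to the formal solution. -/
theorem BorelSummableInDirection.of_formalSubst_eq_zero {ν ε α : ℝ} (hν : 0 < ν) (hε : 0 < ε)
    {F : ℕ → BoundedAnalytic ε} (hF0 : discEval (F 0) 0 = 0)
    (hF1 : deriv (discEval (F 0)) 0 ≠ 0) {g : PowerSeries ℂ}
    (hg : PowerSeries.constantCoeff g = 0) (hFg : formalSubst F g = 0)
    (hF : BorelSummableInDirection ν F α) :
    BorelSummableInDirection ν (fun n => PowerSeries.coeff n g) α := by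
  obtain ⟨δ, ρ, hδ, hρ, f, hfan, hfG⟩ := hF
  set s := 1 / ν with hs
  have hs0 : 0 < s := by positivity
  have hπ : 0 < Real.pi / ν := div_pos Real.pi_pos hν
  -- a slightly smaller sector, still of opening larger than `π / ν`, with uniform constants
  set δ' := (Real.pi / ν / 2 + δ) / 2 with hδ'
  have hδ1 : Real.pi / ν < 2 * δ' := by rw [hδ']; linarith
  have hδ2 : δ' < δ := by rw [hδ']; linarith
  have hδ0 : 0 < δ' := by linarith
  obtain ⟨C, A, hC, hA, hCA⟩ := hfG (α - δ') (α + δ') (ρ / 2) (by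
    refine (closure_sector_subset _ _ _).trans fun w hw => ⟨?_, ?_, ?_⟩
    · linarith [hw.1]
    · linarith [hw.2.1]
    · linarith [hw.2.2])
  have hFj : ∀ j : ℕ, 0 < j → ‖F j‖ ≤ C * A ^ j * Real.Gamma (1 + s * j) := fun j hj =>
    norm_coeff_le_of_gevrey (by linarith) (by positivity) hCA hj
  obtain ⟨η, κ, hη, hκ, hηε, hcontr⟩ := exists_contractsNear hε (F 0) hF0 hF1
  set a := deriv (discEval (F 0)) 0 with ha
  have hΓ1 : 0 < Real.Gamma (1 + s * (1 : ℕ)) := Real.Gamma_pos_of_pos (by positivity)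
  -- on this sector `f` stays `κ`-close to `F 0`
  set ρ' := min (ρ / 2) (κ / (C * A * Real.Gamma (1 + s * (1 : ℕ)))) with hρ'
  have hρ0 : 0 < ρ' := by positivity
  have hsub : sector (α - δ') (α + δ') ρ' ⊆ sector (α - δ') (α + δ') (ρ / 2) := fun w hw =>
    ⟨hw.1, hw.2.1, hw.2.2.trans_le (min_le_left _ _)⟩
  have hsub2 : sector (α - δ') (α + δ') ρ' ⊆ sector (α - δ) (α + δ) ρ := fun w hw =>
    ⟨by linarith [hw.1], by linarith [hw.2.1], by linarith [(hsub hw).2.2]⟩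
  have hfκ : ∀ w ∈ sector (α - δ') (α + δ') ρ', ‖f w - F 0‖ ≤ κ := by
    intro w hw
    have h1 := hCA 1 one_pos w (hsub hw)
    rw [Finset.sum_range_one, pow_zero, one_smul, pow_one, pow_one] at h1
    have h2 : ‖Complex.exp w‖ ≤ κ / (C * A * Real.Gamma (1 + s * (1 : ℕ))) :=
      hw.2.2.le.trans (min_le_right _ _)
    rw [le_div_iff₀ (by positivity)] at h2
    linarith
  obtain ⟨φ, hφd, hφ⟩ := exists_differentiableOn_zero hε hF1 hη hηε
    (isOpen_sector (α - δ') (α + δ') ρ') (hfan.differentiableOn.mono hsub2)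
    (fun u hu => (hcontr _ (hfκ u hu)).1) (fun u hu => (hcontr _ (hfκ u hu)).2)
  set c := min (1 / 2) (κ / (2 * C)) / A with hc
  have hc0 : 0 < c := by positivity
  have hAc : A * c = min (1 / 2) (κ / (2 * C)) := by rw [hc]; field_simp
  have hcA : A * c ≤ 1 / 2 := hAc.trans_le (min_le_left _ _)
  have hcκ : 2 * C * (A * c) ≤ κ := by
    have := hAc.trans_le (min_le_right _ _)
    rw [le_div_iff₀ (by positivity)] at this
    linarith
  refine ⟨δ', ρ', hδ1, hρ0, φ, hφd.analyticOnNhd (isOpen_sector _ _ _), fun a' b' r' hcl =>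
    ⟨2 / ‖a‖ * C + 2 * η, A + 8 / c, by positivity, by positivity, fun N hN w hw => ?_⟩⟩
  replace hw := hcl (subset_closure hw)
  set x := Complex.exp w with hx
  set Γr := Real.Gamma (1 + s * N) ^ (1 / (N : ℝ)) with hΓr
  have hΓpos : 0 < Real.Gamma (1 + s * N) := Real.Gamma_pos_of_pos (by positivity)
  have hΓrpos : 0 < Γr := Real.rpow_pos_of_pos hΓpos _
  have hΓN : Γr ^ N = Real.Gamma (1 + s * N) := rpow_one_div_natCast_pow hΓpos.le hN
  obtain ⟨h, hd, hz, hgc⟩ := exists_solution_of_truncation hε hs0 hC hA hη hηε hc0 hcA hcκ hF0 hF1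
    hFj hcontr hg hFg hN rfl
  rw [← hΓr] at hd hz
  set R := c / Γr with hR
  have hR0 : 0 < R := div_pos hc0 hΓrpos
  have hb : ∀ x ∈ ball (0 : ℂ) R, ‖h x‖ ≤ η := fun x hx =>
    mem_closedBall_zero_iff.1 (hz x hx).1
  have hrR : R / 2 < R := half_lt_self hR0
  have hpow : (4 * ‖x‖ / (R / 2)) ^ N = ‖x‖ ^ N * (8 / c) ^ N * Real.Gamma (1 + s * N) := by
    rw [← hΓN, ← mul_pow, ← mul_pow, hR]
    congr 1
    field_simp
    ring
  have hφη : ‖φ w‖ ≤ η := mem_closedBall_zero_iff.1 (hφ w hw).1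
  have hmono1 : A ^ N ≤ (A + 8 / c) ^ N := by
    gcongr
    linarith [div_pos (by norm_num : (0 : ℝ) < 8) hc0]
  have hmono2 : (8 / c) ^ N ≤ (A + 8 / c) ^ N := by
    gcongr
    linarith
  have hfin : ∀ n ∈ Finset.range N, x ^ n • PowerSeries.coeff n g =
      x ^ n • PowerSeries.coeff n (taylorAtZero h) := fun n hn => by
    rw [hgc n (Finset.mem_range.1 hn)]
  rw [Finset.sum_congr rfl hfin]
  rcases le_or_gt ‖x‖ (R / 2 / 2) with hxs | hxl
  · have hxR : x ∈ ball (0 : ℂ) R := by rw [mem_ball_zero_iff]; linarith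
    have hT := norm_sub_taylorAtZero_le hd hb (half_pos hR0) hrR hxs N
    -- `h x` is almost a zero of `f w`, hence close to the zero `φ w`
    have hS := norm_sub_le_of_contraction
      ((hcontr _ (hfκ w hw)).2 _ (hφ w hw).1 _ (hz x hxR).1)
    have hD : ‖discEval (f w) (φ w) - discEval (f w) (h x)‖ ≤
        C * ‖x‖ ^ N * A ^ N * Real.Gamma (1 + s * N) := by
      have e : discEval (f w) (φ w) - discEval (f w) (h x) =
          -discEval (f w - ∑ j ∈ Finset.range N, x ^ j • F j) (h x) := by
        rw [discEval_sub, (hφ w hw).2, (hz x hxR).2]; ring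
      rw [e, norm_neg]
      exact (norm_discEval_le _ _).trans (hCA N hN w (hsub hw))
    have hT' : 2 * η * (‖x‖ / (R / 2)) ^ N ≤
        2 * η * (‖x‖ ^ N * (8 / c) ^ N * Real.Gamma (1 + s * N)) := by
      rw [← hpow]
      gcongr
      linarith [norm_nonneg x]
    calc ‖φ w - ∑ n ∈ Finset.range N, x ^ n • PowerSeries.coeff n (taylorAtZero h)‖
        ≤ ‖φ w - h x‖ + ‖h x - ∑ n ∈ Finset.range N,
            x ^ n • PowerSeries.coeff n (taylorAtZero h)‖ := norm_sub_le_norm_sub_add_norm_sub _ _ _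
      _ ≤ 2 / ‖a‖ * (C * ‖x‖ ^ N * A ^ N * Real.Gamma (1 + s * N)) +
            2 * η * (‖x‖ ^ N * (8 / c) ^ N * Real.Gamma (1 + s * N)) :=
          add_le_add (hS.trans (by gcongr)) (hT.trans hT')
      _ ≤ 2 / ‖a‖ * (C * ‖x‖ ^ N * (A + 8 / c) ^ N * Real.Gamma (1 + s * N)) +
            2 * η * (‖x‖ ^ N * (A + 8 / c) ^ N * Real.Gamma (1 + s * N)) := by gcongr
      _ = (2 / ‖a‖ * C + 2 * η) * ‖x‖ ^ N * (A + 8 / c) ^ N * Real.Gamma (1 + s * N) := by ring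
  · refine (norm_sub_sum_le_of_lt hη.le (half_pos hR0)
      (fun n _ => norm_coeff_taylorAtZero_mul_pow_le hd hb (half_pos hR0) hrR n) hxl hφη).trans ?_
    rw [hpow]
    have hη2 : η ≤ 2 / ‖a‖ * C + 2 * η := by
      have : 0 ≤ 2 / ‖a‖ * C := by positivity
      linarith
    calc η * (‖x‖ ^ N * (8 / c) ^ N * Real.Gamma (1 + s * N))
        ≤ (2 / ‖a‖ * C + 2 * η) * (‖x‖ ^ N * (A + 8 / c) ^ N * Real.Gamma (1 + s * N)) := by gcongr
      _ = (2 / ‖a‖ * C + 2 * η) * ‖x‖ ^ N * (A + 8 / c) ^ N * Real.Gamma (1 + s * N) := by ring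

end Gevrey

end BorelIFT

theorem mainTheorem12 (ν ε : ℝ) (hν : 0 < ν) (hε : 0 < ε)
    (F : ℕ → BorelIFT.BoundedAnalytic ε)
    (hF : BorelIFT.BorelSummable ν F)
    (hF0 : BorelIFT.discEval (F 0) 0 = 0)
    (hF1 : deriv (BorelIFT.discEval (F 0)) 0 ≠ 0) :
    ∃ g : PowerSeries ℂ,
      (PowerSeries.constantCoeff g = 0 ∧ BorelIFT.formalSubst F g = 0) ∧
      (∀ h : PowerSeries ℂ, PowerSeries.constantCoeff h = 0 → BorelIFT.formalSubst F h = 0 →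
        h = g) ∧
      BorelIFT.BorelSummable ν (fun n => PowerSeries.coeff n g) ∧
      BorelIFT.singularDirections ν (fun n => PowerSeries.coeff n g) ⊆
        BorelIFT.singularDirections ν F := by
  have h0 : PowerSeries.coeff 0 (BorelIFT.taylorSeries (F 0)) = 0 := by
    simpa [BorelIFT.taylorSeries] using hF0
  have h1 : PowerSeries.coeff 1 (BorelIFT.taylorSeries (F 0)) ≠ 0 := by
    simpa [BorelIFT.taylorSeries] using hF1
  obtain ⟨g, hg, hFg⟩ := BorelIFT.exists_twoVarSubst_eq_zero
    (a := fun j => BorelIFT.taylorSeries (F j)) h0 h1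
  have hsing : BorelIFT.singularDirections ν (fun n => PowerSeries.coeff n g) ⊆
      BorelIFT.singularDirections ν F := fun α hα =>
    ⟨hα.1, fun h => hα.2 (h.of_formalSubst_eq_zero hν hε hF0 hF1 hg hFg)⟩
  exact ⟨g, ⟨hg, hFg⟩,
    fun h hh hFh => BorelIFT.eq_of_twoVarSubst_eq_zero
      (a := fun j => BorelIFT.taylorSeries (F j)) h1 hg hh hFg hFh,
    hF.subset hsing, hsing⟩
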